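/- All manifolds are smooth, finite-dimensional and without boundary. A Riemannian manifold carries its Riemannian distance, the infimum of the lengths of the curves joining two points; it is taken to be $\infty$ if no such curve exists, so that it is an ordinary metric when the manifold is connected. A smooth map $\pi: M\to B$ of Riemannian manifolds is a Riemannian submersion if it is surjective, each derivative $(\pi_*)_x : T_xM\to T_{\pi(x)}B$ is surjective, and $\|(\pi_*)_x v\|=\|v\|$ for all $x \in M$ and all horizontal $v\in T_xM$, i.e. all $v$ orthogonal to $\ker (\pi_*)_x$. A map $\varphi: X\to Y$ between metric spaces $(X,\delta)$ and $(Y,d)$ (distances may be infinite), not necessarily continuous, is a rough isometry if (1) there are constants $A\ge 1$, $C\ge 0$ with $\frac1A\,\delta(p_1,p_2)-C\le d(\varphi(p_1),\varphi(p_2))\le A\,\delta(p_1,p_2)+C$ for all $p_1,p_2\in X$, and (2) there is $\varepsilon>0$ such that every $q\in Y$ satisfies $d(q,\varphi(X))<\varepsilon$. $X$ is roughly isometric to $Y$ if there is a rough isometry $X\to Y$. **Theorem.** Let $M$ and $B$ be Riemannian manifolds with $M$ complete and $B$ compact and connected, and let $\pi: M\to B$ be a Riemannian submersion. For each $b\in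 B$ endow the fiber $\pi^{-1}(b)$ with the metric induced from $(M,d)$, i.e. the restriction to $\pi^{-1}(b)$ of the Riemannian distance $d$ of $M$. Then for each $b\in B$ the inclusion $\iota:\pi^{-1}(b)\hookrightarrow M$ is a rough isometry. In particular, for each $b\in B$, $M$ is roughly isometric to the product $\pi^{-1}(b)\times B$ with the product metric $\sqrt{d_{\pi^{-1}(b)}^2+d_B^2}$. -/

import Mathlib

open Bundle Manifold
open scoped ContDiff ENNReal NNReal Manifold

/-- A map `φ : X → Y`, not necessarily continuous, is a rough isometry if it is a quasi-isometric
embedding with some constants `A ≥ 1`, `C ≥ 0`, and its image is `ε`-full for some `ε > 0`, i.e.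
every point of `Y` has distance less than `ε` from the image. Distances may be infinite (as between
points of different components of a Riemannian manifold); for metric spaces see
`isRoughIsometry_iff_dist`. -/
structure IsRoughIsometry {X Y : Type*} [PseudoEMetricSpace X] [PseudoEMetricSpace Y]
    (φ : X → Y) : Prop where
  quasi : ∃ A C : ℝ≥0, 1 ≤ A ∧ ∀ p q : X,
    edist p q / A - C ≤ edist (φ p) (φ q) ∧ edist (φ p) (φ q) ≤ A * edist p q + C
  full : ∃ ε : ℝ, 0 < ε ∧ Metric.thickening ε (Set.range φ) = Set.univ

/-- Between metric spaces, `IsRoughIsometry` is the usual notion with real-valued distances. -/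
theorem isRoughIsometry_iff_dist {X Y : Type*} [MetricSpace X] [MetricSpace Y] (φ : X → Y) :
    IsRoughIsometry φ ↔
      (∃ A C : ℝ, 1 ≤ A ∧ 0 ≤ C ∧ ∀ p q : X,
        1 / A * dist p q - C ≤ dist (φ p) (φ q) ∧ dist (φ p) (φ q) ≤ A * dist p q + C) ∧
      ∃ ε : ℝ, 0 < ε ∧ ∀ y : Y, ∃ x : X, dist y (φ x) < ε := by
  have key : ∀ (A C : ℝ≥0), 1 ≤ A → ∀ p q : X,
      (edist p q / A - C ≤ edist (φ p) (φ q) ∧ edist (φ p) (φ q) ≤ A * edist p q + C) ↔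
      (1 / (A : ℝ) * dist p q - C ≤ dist (φ p) (φ q) ∧
        dist (φ p) (φ q) ≤ A * dist p q + C) := by
    intro A C hA p q
    have hA0 : A ≠ 0 := (zero_lt_one.trans_le hA).ne'
    rw [tsub_le_iff_right, sub_le_iff_le_add, edist_nndist, edist_nndist,
      ← ENNReal.coe_div hA0]
    simp only [← NNReal.coe_le_coe, ← coe_nndist, ← ENNReal.coe_mul, ← ENNReal.coe_add,
      ENNReal.coe_le_coe]
    push_cast
    rw [div_eq_inv_mul, one_div]
  constructor
  · rintro ⟨⟨A, C, hA, h⟩, ε, hε, hf⟩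
    refine ⟨⟨A, C, by exact_mod_cast hA, C.2, fun p q => (key A C hA p q).1 (h p q)⟩,
      ε, hε, fun y => ?_⟩
    have hy : y ∈ Metric.thickening ε (Set.range φ) := hf ▸ Set.mem_univ y
    simpa [Metric.mem_thickening_iff] using hy
  · rintro ⟨⟨A, C, hA, hC, h⟩, ε, hε, hf⟩
    lift A to ℝ≥0 using zero_le_one.trans hA
    lift C to ℝ≥0 using hC
    have hA' : 1 ≤ A := by exact_mod_cast hA
    refine ⟨⟨A, C, hA', fun p q => (key A C hA' p q).2 (h p q)⟩, ε, hε, ?_⟩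
    refine Set.eq_univ_of_forall fun y => ?_
    simpa [Metric.mem_thickening_iff] using hf y

/-- `X` is roughly isometric to `Y` if there is a rough isometry from `X` to `Y`. -/
def RoughlyIsometric (X Y : Type*) [PseudoEMetricSpace X] [PseudoEMetricSpace Y] : Prop :=
  ∃ φ : X → Y, IsRoughIsometry φ

/-- The vertical space at `x` of a map `f`: the kernel of the derivative of `f` at `x`. For a map of
maximal rank it is the tangent space at `x` to the fiber through `x`. -/
noncomputable def verticalSpace {m n : ℕ}
    {M : Type*} [TopologicalSpace M] [ChartedSpace (EuclideanSpace ℝ (Fin m)) M]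
    {B : Type*} [TopologicalSpace B] [ChartedSpace (EuclideanSpace ℝ (Fin n)) B]
    (f : M → B) (x : M) : Submodule ℝ (TangentSpace (𝓡 m) x) :=
  (mfderiv (𝓡 m) (𝓡 n) f x).ker

/-- A Riemannian submersion between manifolds with Riemannian metrics on their tangent bundles: a
smooth surjective map of maximal rank whose derivative preserves the lengths of horizontal vectors,
that is, of the vectors orthogonal to the vertical space. -/
structure IsRiemannianSubmersion {m n : ℕ}
    {M : Type*} [TopologicalSpace M] [ChartedSpace (EuclideanSpace ℝ (Fin m)) M]
    [RiemannianBundle (fun x : M => TangentSpace (𝓡 m) x)]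
    {B : Type*} [TopologicalSpace B] [ChartedSpace (EuclideanSpace ℝ (Fin n)) B]
    [RiemannianBundle (fun b : B => TangentSpace (𝓡 n) b)]
    (f : M → B) : Prop where
  surjective : Function.Surjective f
  contMDiff : ContMDiff (𝓡 m) (𝓡 n) ∞ f
  maximal_rank : ∀ x : M, Function.Surjective (mfderiv (𝓡 m) (𝓡 n) f x)
  norm_horizontal : ∀ (x : M) (v : TangentSpace (𝓡 m) x),
    (∀ u ∈ verticalSpace (m := m) (n := n) f x, inner ℝ u v = 0) →
      ‖mfderiv (𝓡 m) (𝓡 n) f x v‖ = ‖v‖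

/-!
The fiber over `b` carries the restricted distance, so its inclusion is an isometric embedding, and
everything reduces to the fact that it is coarsely dense. This holds because a Riemannian submersion
`f` with complete total space is a submetry
(`IsRiemannianSubmersion.exists_mem_fiber_edist_lt`): the fiber over `b` comes as close to `x` as `b`
is to `f x`, and this last distance is bounded since `B` is compact and connected.

Classically, one lifts a short curve `γ` from `f x` to `b` horizontally. Here no differential equation
is solved. Near each time, `γ` is lifted through a given point by a local section of `f` whose
derivative at that point is the horizontal lift (`exists_local_section`,
`IsRiemannianSubmersion.exists_horizontal_lift`). The lift has the speed of `γ` at the initial time,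
hence at most this speed plus `η` for a short while, since speeds of `C^1` curves are continuous
(`continuousAt_norm_mfderiv_one`). So one can follow `γ` a little further from every point over it, at
a cost of at most the length of the piece of `γ` plus `η` times the elapsed time. By Zorn's lemma
and the completeness of the total space, these steps reach the fiber over `b`
(`exists_lift_endpoint_of_local_lift`), and `η` is arbitrary.

For the comparison with the product, `x` is sent to `(y, b)` with `y` a point of the fiber close to
`x` (`roughlyIsometric_withLp_prod_of_dense`).
-/

section

open Set Filter Topology MeasureTheory

/-! ### Lifting curves by local steps -/

/-- If a curve `γ` can be followed a little further in `X` from every point over it, at a cost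
measured by the increments of `F`, then its endpoint can be reached at the total cost. By
completeness, chains of points `(t, z)` with `z` over `γ t`, ordered by "reachable within the cost",
are bounded above, and a maximal point can only lie over the endpoint. The local steps need not fit
together into a continuous lift. -/
theorem exists_lift_endpoint_of_local_lift {X Y : Type*} [PseudoEMetricSpace X] [CompleteSpace X]
    [TopologicalSpace Y] [T2Space Y] {f : X → Y} (hf : Continuous f) {γ : ℝ → Y}
    (hγ : Continuous γ) {F : ℝ → ℝ} (hF : Continuous F) (hmono : Monotone F) {a b : ℝ}
    (hab : a ≤ b)
    (step : ∀ t ∈ Ico a b, ∀ x, f x = γ t →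
      ∃ s ∈ Ioc t b, ∃ y, f y = γ s ∧ edist x y ≤ ENNReal.ofReal (F s - F t))
    {x : X} (hx : f x = γ a) :
    ∃ y, f y = γ b ∧ edist x y ≤ ENNReal.ofReal (F b - F a) := by
  have trans_le : ∀ {t₁ t₂ t₃ : ℝ} {x₁ x₂ x₃ : X}, t₁ ≤ t₂ → t₂ ≤ t₃ →
      edist x₁ x₂ ≤ ENNReal.ofReal (F t₂ - F t₁) → edist x₂ x₃ ≤ ENNReal.ofReal (F t₃ - F t₂) →
      edist x₁ x₃ ≤ ENNReal.ofReal (F t₃ - F t₁) := by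
    intro t₁ t₂ t₃ x₁ x₂ x₃ h₁₂ h₂₃ h h'
    calc edist x₁ x₃ ≤ ENNReal.ofReal (F t₂ - F t₁) + ENNReal.ofReal (F t₃ - F t₂) :=
          (edist_triangle _ _ _).trans (add_le_add h h')
      _ = ENNReal.ofReal (F t₃ - F t₁) := by
          rw [← ENNReal.ofReal_add (sub_nonneg.2 (hmono h₁₂)) (sub_nonneg.2 (hmono h₂₃))]
          ring_nf
  let α := {p : ℝ × X // p.1 ∈ Icc a b ∧ f p.2 = γ p.1 ∧
    edist x p.2 ≤ ENNReal.ofReal (F p.1 - F a)}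
  let r : α → α → Prop := fun p q =>
    p.1.1 ≤ q.1.1 ∧ edist p.1.2 q.1.2 ≤ ENNReal.ofReal (F q.1.1 - F p.1.1)
  have edist_F : ∀ {s t : ℝ}, s ≤ t → edist (F s) (F t) = ENNReal.ofReal (F t - F s) := by
    intro s t hst
    rw [edist_comm, edist_dist, Real.dist_eq, abs_of_nonneg (sub_nonneg.2 (hmono hst))]
  have : Nonempty α := ⟨⟨(a, x), ⟨le_rfl, hab⟩, hx, by simp⟩⟩
  obtain ⟨m, hm⟩ : ∃ m : α, ∀ p, r m p → r p m := by
    refine exists_maximal_of_nonempty_chains_bounded (fun c hc hne => ?_)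
      (fun {p q s} hpq hqs => ⟨hpq.1.trans hqs.1, trans_le hpq.1 hqs.1 hpq.2 hqs.2⟩)
    -- Along a chain the second coordinate is Lipschitz with respect to `F` of the first one, so it
    -- converges when the first coordinate tends to its supremum.
    have key : ∀ p ∈ c, ∀ q ∈ c, edist p.1.2 q.1.2 ≤ edist (F p.1.1) (F q.1.1) := by
      intro p hp q hq
      by_cases hpq : p = q
      · simp [hpq]
      rcases hc hp hq hpq with h | h
      · exact h.2.trans_eq (edist_F h.1).symm
      · rw [edist_comm, edist_comm (F _)]
        exact h.2.trans_eq (edist_F h.1).symm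
    let S : Set ℝ := (fun p : α => p.1.1) '' c
    have hSne : S.Nonempty := hne.image _
    have hSb : BddAbove S := ⟨b, by rintro _ ⟨p, -, rfl⟩; exact p.2.1.2⟩
    obtain ⟨u, -, hu, huS⟩ := exists_seq_tendsto_sSup hSne hSb
    choose p hpc hpu using huS
    have hpu' : Tendsto (fun n => (p n).1.1) atTop (𝓝 (sSup S)) := by simpa only [hpu] using hu
    have hFu : Tendsto (fun n => F (p n).1.1) atTop (𝓝 (F (sSup S))) := (hF.tendsto _).comp hpu'
    have hcauchy : CauchySeq fun n => (p n).1.2 := by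
      rw [EMetric.cauchySeq_iff]
      intro ε hε
      obtain ⟨N, hN⟩ := EMetric.cauchySeq_iff.1 hFu.cauchySeq ε hε
      exact ⟨N, fun k hk l hl => (key _ (hpc k) _ (hpc l)).trans_lt (hN k hk l hl)⟩
    obtain ⟨y, hy⟩ := cauchySeq_tendsto_of_complete hcauchy
    have hle : ∀ q ∈ c, q.1.1 ≤ sSup S := fun q hq => le_csSup hSb ⟨q, hq, rfl⟩
    have hedist : ∀ q ∈ c, edist q.1.2 y ≤ ENNReal.ofReal (F (sSup S) - F q.1.1) := by
      intro q hq
      rw [← edist_F (hle q hq)]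
      exact le_of_tendsto_of_tendsto' (tendsto_const_nhds.edist hy)
        (tendsto_const_nhds.edist hFu) fun n => key q hq _ (hpc n)
    obtain ⟨q, hq⟩ := hne
    refine ⟨⟨(sSup S, y), ⟨q.2.1.1.trans (hle q hq), csSup_le hSne ?_⟩, ?_, ?_⟩,
      fun q' hq' => ⟨hle q' hq', hedist q' hq'⟩⟩
    · rintro _ ⟨q', -, rfl⟩
      exact q'.2.1.2
    · refine tendsto_nhds_unique ((hf.tendsto y).comp hy) ?_
      simpa only [Function.comp_def, (p _).2.2.1] using (hγ.tendsto _).comp hpu'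
    · exact trans_le q.2.1.1 (hle q hq) q.2.2.2 (hedist q hq)
  obtain ⟨⟨⟨t, z⟩, ht, hz, hxz⟩, hm⟩ : ∃ m' : α, m' = m := ⟨m, rfl⟩
  subst hm
  rcases ht.2.eq_or_lt with htb | htb
  · dsimp only at htb
    subst htb
    exact ⟨z, hz, hxz⟩
  · obtain ⟨s, hs, y, hy, hzy⟩ := step t ⟨ht.1, htb⟩ z hz
    have h := hm ⟨(s, y), ⟨ht.1.trans hs.1.le, hs.2⟩, hy, trans_le ht.1 hs.1.le hxz hzy⟩
      ⟨hs.1.le, hzy⟩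
    exact absurd h.1 (not_le.2 hs.1)

/-! ### Speed of curves -/

theorem isContinuousRiemannianBundle_of_isContMDiffRiemannianBundle
    {E : Type*} [NormedAddCommGroup E] [NormedSpace ℝ E]
    {H : Type*} [TopologicalSpace H] (I : ModelWithCorners ℝ E H)
    {M : Type*} [TopologicalSpace M] [ChartedSpace H M] [IsManifold I ∞ M]
    [RiemannianBundle (fun x : M => TangentSpace I x)]
    [h : IsContMDiffRiemannianBundle I ∞ E (fun x : M => TangentSpace I x)] :
    IsContinuousRiemannianBundle E (fun x : M => TangentSpace I x) := by
  obtain ⟨g, hg, hinner⟩ := h.exists_contMDiff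
  exact ⟨g, hg.continuous, hinner⟩

/-- The speed of a `C^1` curve is continuous. -/
theorem continuousAt_norm_mfderiv_one {E : Type*} [NormedAddCommGroup E] [NormedSpace ℝ E]
    {H : Type*} [TopologicalSpace H] {I : ModelWithCorners ℝ E H}
    {M : Type*} [TopologicalSpace M] [ChartedSpace H M] [IsManifold I 1 M]
    [RiemannianBundle (fun x : M => TangentSpace I x)]
    [IsContinuousRiemannianBundle E (fun x : M => TangentSpace I x)]
    {σ : ℝ → M} {t : ℝ} (hσ : ContMDiffAt 𝓘(ℝ, ℝ) I 1 σ t) :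
    ContinuousAt (fun u => ‖mfderiv 𝓘(ℝ, ℝ) I σ u 1‖) t := by
  obtain ⟨U, hU, hUo, htU⟩ := eventually_nhds_iff.1
    ((contMDiffAt_iff_contMDiffAt_nhds (by simp)).1 hσ)
  have hσU : ContMDiffOn 𝓘(ℝ, ℝ) I 1 σ U := fun u hu => (hU u hu).contMDiffWithinAt
  have h1 := hσU.continuousOn_tangentMapWithin le_rfl hUo.uniqueMDiffOn
  have h2 : Continuous (fun u : ℝ => (⟨u, 1⟩ : TangentBundle 𝓘(ℝ, ℝ) ℝ)) :=
    (tangentBundleModelSpaceHomeomorph 𝓘(ℝ, ℝ)).symm.continuous.comp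
      (by fun_prop : Continuous fun u : ℝ => ((u, 1) : ModelProd ℝ ℝ))
  have h3 : ContinuousAt (fun u : ℝ =>
      (⟨σ u, mfderiv 𝓘(ℝ, ℝ) I σ u 1⟩ : TangentBundle I M)) t := by
    have h4 := h1.comp (s := U) h2.continuousOn (fun u hu => hu)
    refine (h4.continuousAt (hUo.mem_nhds htU)).congr ?_
    filter_upwards [hUo.mem_nhds htU] with u hu
    simp [tangentMapWithin, mfderivWithin_of_isOpen hUo hu]
  have h5 := h3.inner_bundle h3
  have : (fun u => ‖mfderiv 𝓘(ℝ, ℝ) I σ u 1‖) =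
      fun u => √(inner ℝ (mfderiv 𝓘(ℝ, ℝ) I σ u 1) (mfderiv 𝓘(ℝ, ℝ) I σ u 1)) := by
    ext u; exact norm_eq_sqrt_real_inner _
  rw [this]
  exact h5.sqrt

/-! ### Local sections and horizontal lifts -/

/-- A `C^1` map has a `C^1` local section through `x` with any prescribed right inverse `R` of its
derivative at `x` as derivative. The preferred extended charts at `x` and `f x` have the identity as
derivative there, so in these charts `w ↦ x + R w` is a section to first order; the inverse function
theorem, applied to its composition with `f`, corrects it to an actual section. -/
theorem exists_local_section {E : Type*} [NormedAddCommGroup E] [NormedSpace ℝ E]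
    {E' : Type*} [NormedAddCommGroup E'] [NormedSpace ℝ E'] [CompleteSpace E']
    {M : Type*} [TopologicalSpace M] [ChartedSpace E M] [IsManifold 𝓘(ℝ, E) 1 M]
    {B : Type*} [TopologicalSpace B] [ChartedSpace E' B] [IsManifold 𝓘(ℝ, E') 1 B]
    {f : M → B} {x : M} (hf : ContMDiffAt 𝓘(ℝ, E) 𝓘(ℝ, E') 1 f x)
    (R : TangentSpace 𝓘(ℝ, E') (f x) →L[ℝ] TangentSpace 𝓘(ℝ, E) x)
    (hR : ∀ v, mfderiv 𝓘(ℝ, E) 𝓘(ℝ, E') f x (R v) = v) :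
    ∃ s : B → M, ContMDiffAt 𝓘(ℝ, E') 𝓘(ℝ, E) 1 s (f x) ∧ s (f x) = x ∧
      (∀ᶠ y in 𝓝 (f x), f (s y) = y) ∧
      HasMFDerivAt 𝓘(ℝ, E') 𝓘(ℝ, E) s (f x) R := by
  set φ := extChartAt 𝓘(ℝ, E) x with hφ
  set ψ := extChartAt 𝓘(ℝ, E') (f x) with hψ
  let R' : E' →L[ℝ] E := R
  let f' : E → E' := ψ ∘ f ∘ φ.symm
  let A : E →L[ℝ] E' := mfderiv 𝓘(ℝ, E) 𝓘(ℝ, E') f x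
  have hf'1 : ContDiffAt ℝ 1 f' (φ x) := by
    have := (contMDiffAt_iff.1 hf).2
    rwa [modelWithCornersSelf_coe, range_id, contDiffWithinAt_univ] at this
  have hf'2 : HasFDerivAt f' A (φ x) := by
    have : HasFDerivWithinAt f' A (range 𝓘(ℝ, E)) (φ x) :=
      (hf.mdifferentiableAt one_ne_zero).hasMFDerivAt.2
    rwa [modelWithCornersSelf_coe, range_id, hasFDerivWithinAt_univ] at this
  -- `g` is `f` along the slice through `x` in the directions of the range of `R`, read in the charts.
  let g : E' → E' := fun v => f' (φ x + R' v)
  have hR'1 : ContDiffAt ℝ 1 (fun v => φ x + R' v) 0 := by fun_prop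
  have hR'2 : ∀ v, HasFDerivAt (fun v => φ x + R' v) R' v := fun v => R'.hasFDerivAt.const_add _
  have hg1 : ContDiffAt ℝ 1 g 0 := ContDiffAt.comp (g := f') 0 (by simpa using hf'1) hR'1
  have hg2 : HasFDerivAt g ((ContinuousLinearEquiv.refl ℝ E' : E' ≃L[ℝ] E') : E' →L[ℝ] E') 0 := by
    have h := HasFDerivAt.comp (0 : E') (g := f') (g' := A) (by simpa using hf'2) (hR'2 0)
    convert! h using 1
    ext v
    exact (hR v).symm
  have hg0 : g 0 = ψ (f x) := by simp [g, f', hφ, hψ]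
  have hgs := hg1.hasStrictFDerivAt' hg2 one_ne_zero
  let k : E' → E' := hg1.localInverse hg2 one_ne_zero
  have hk0 : k (ψ (f x)) = 0 := hg0 ▸ hg1.localInverse_apply_image hg2 one_ne_zero
  have hk1 : ContDiffAt ℝ 1 k (ψ (f x)) := hg0 ▸ hg1.to_localInverse hg2 one_ne_zero
  have hk2 : HasFDerivAt k (ContinuousLinearMap.id ℝ E') (ψ (f x)) := by
    have := hgs.to_localInverse.hasFDerivAt
    rw [hg0] at this
    exact this
  have hgk : ∀ᶠ w in 𝓝 (ψ (f x)), g (k w) = w := hg0 ▸ hgs.eventually_right_inverse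
  let l : E' → E := fun w => φ x + R' (k w)
  have hl0 : l (ψ (f x)) = φ x := by simp [l, hk0]
  have hl1 : ContDiffAt ℝ 1 l (ψ (f x)) := by
    exact contDiffAt_const.add (R'.contDiff.contDiffAt.comp _ hk1)
  have hl2 : HasFDerivAt l R' (ψ (f x)) := by
    simpa using! (hR'2 (k (ψ (f x)))).comp _ hk2
  let s : B → M := φ.symm ∘ l ∘ ψ
  have hs0 : s (f x) = x := by simp [s, hl0, hφ]
  have hs1 : ContMDiffAt 𝓘(ℝ, E') 𝓘(ℝ, E) 1 s (f x) := by
    have h1 : ContMDiffAt 𝓘(ℝ, E) 𝓘(ℝ, E) 1 φ.symm (l (ψ (f x))) := by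
      rw [hl0]
      exact (contMDiffOn_extChartAt_symm x).contMDiffAt (extChartAt_target_mem_nhds x)
    exact h1.comp (f x) (hl1.contMDiffAt.comp (f x) contMDiffAt_extChartAt)
  refine ⟨s, hs1, hs0, ?_, hs1.continuousAt, ?_⟩
  · have h1 : ∀ᶠ y in 𝓝 (f x), g (k (ψ y)) = ψ y :=
      (continuousAt_extChartAt (f x)).eventually hgk
    have h2 : ∀ᶠ y in 𝓝 (f x), f (s y) ∈ ψ.source := by
      have : ContinuousAt (fun y => f (s y)) (f x) :=
        ContinuousAt.comp (by rw [hs0]; exact hf.continuousAt) hs1.continuousAt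
      refine this.eventually_mem ?_
      rw [hs0]
      exact extChartAt_source_mem_nhds (f x)
    filter_upwards [h1, h2, extChartAt_source_mem_nhds (I := 𝓘(ℝ, E')) (f x)] with y h1 h2 h3
    exact ψ.injOn h2 h3 h1
  · have h1 : writtenInExtChartAt 𝓘(ℝ, E') 𝓘(ℝ, E) (f x) s =ᶠ[𝓝 (ψ (f x))] l := by
      have h2 : ∀ᶠ w in 𝓝 (ψ (f x)), l w ∈ φ.target :=
        hl1.continuousAt.eventually_mem (by rw [hl0]; exact extChartAt_target_mem_nhds x)
      filter_upwards [h2, extChartAt_target_mem_nhds (I := 𝓘(ℝ, E')) (f x)] with w h2 h3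
      simp only [writtenInExtChartAt, hs0, Function.comp_apply, s]
      rw [← hφ, ← hψ, ψ.right_inv h3, φ.right_inv h2]
    exact (hl2.congr_of_eventuallyEq h1).hasFDerivWithinAt

/-- The horizontal lift of tangent vectors: subtracting from any right inverse of the derivative its
vertical component gives an isometric right inverse. -/
theorem IsRiemannianSubmersion.exists_horizontal_lift {m n : ℕ}
    {M : Type*} [TopologicalSpace M] [ChartedSpace (EuclideanSpace ℝ (Fin m)) M]
    [RiemannianBundle (fun x : M => TangentSpace (𝓡 m) x)]
    {B : Type*} [TopologicalSpace B] [ChartedSpace (EuclideanSpace ℝ (Fin n)) B]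
    [RiemannianBundle (fun b : B => TangentSpace (𝓡 n) b)]
    {f : M → B} (hf : IsRiemannianSubmersion (m := m) (n := n) f) (x : M) :
    ∃ R : TangentSpace (𝓡 n) (f x) →L[ℝ] TangentSpace (𝓡 m) x,
      (∀ v, mfderiv (𝓡 m) (𝓡 n) f x (R v) = v) ∧ ∀ v, ‖R v‖ = ‖v‖ := by
  have hfdM : FiniteDimensional ℝ (TangentSpace (𝓡 m) x) :=
    inferInstanceAs (FiniteDimensional ℝ (EuclideanSpace ℝ (Fin m)))
  have hfdB : FiniteDimensional ℝ (TangentSpace (𝓡 n) (f x)) :=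
    inferInstanceAs (FiniteDimensional ℝ (EuclideanSpace ℝ (Fin n)))
  let A : TangentSpace (𝓡 m) x →ₗ[ℝ] TangentSpace (𝓡 n) (f x) :=
    (mfderiv (𝓡 m) (𝓡 n) f x).toLinearMap
  let V : Submodule ℝ (TangentSpace (𝓡 m) x) := verticalSpace (m := m) (n := n) f x
  obtain ⟨S, hS⟩ := A.exists_rightInverse_of_surjective
    (LinearMap.range_eq_top.2 (hf.maximal_rank x))
  let R : TangentSpace (𝓡 n) (f x) →ₗ[ℝ] TangentSpace (𝓡 m) x :=
    S - V.starProjection.toLinearMap ∘ₗ S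
  have hR : ∀ v, A (R v) = v := by
    intro v
    have h1 : A (V.starProjection (S v)) = 0 := (V.starProjection_apply_mem (S v) :)
    have h2 : A (S v) = v := LinearMap.congr_fun hS v
    simp [R, h1, h2]
  refine ⟨R.toContinuousLinearMap, hR, fun v => ?_⟩
  have h := hf.norm_horizontal x (R v) (fun u hu =>
    V.sub_starProjection_mem_orthogonal (S v) u hu)
  rw [show mfderiv (𝓡 m) (𝓡 n) f x (R v) = v from hR v] at h
  exact h.symm

/-- A `C^1` curve in the base lifts locally to a `C^1` curve through any given point over it,
with horizontal velocity, hence the same speed, at the time `t`; at other times its velocity may have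
a vertical component. -/
theorem IsRiemannianSubmersion.exists_local_lift {m n : ℕ}
    {M : Type*} [TopologicalSpace M] [ChartedSpace (EuclideanSpace ℝ (Fin m)) M]
    [IsManifold (𝓡 m) 1 M]
    [RiemannianBundle (fun x : M => TangentSpace (𝓡 m) x)]
    {B : Type*} [TopologicalSpace B] [ChartedSpace (EuclideanSpace ℝ (Fin n)) B]
    [IsManifold (𝓡 n) 1 B]
    [RiemannianBundle (fun b : B => TangentSpace (𝓡 n) b)]
    {f : M → B} (hf : IsRiemannianSubmersion (m := m) (n := n) f) {γ : ℝ → B} {t : ℝ}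
    (hγ : ContMDiffAt 𝓘(ℝ, ℝ) (𝓡 n) 1 γ t) {x : M} (hx : f x = γ t) :
    ∃ σ : ℝ → M, ContMDiffAt 𝓘(ℝ, ℝ) (𝓡 m) 1 σ t ∧ σ t = x ∧ (∀ᶠ u in 𝓝 t, f (σ u) = γ u) ∧
      ‖mfderiv 𝓘(ℝ, ℝ) (𝓡 m) σ t 1‖ = ‖mfderiv 𝓘(ℝ, ℝ) (𝓡 n) γ t 1‖ := by
  obtain ⟨R, hR, hRn⟩ := hf.exists_horizontal_lift x
  obtain ⟨s, hs1, hs0, hsf, hsR⟩ := exists_local_section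
    (hf.contMDiff.contMDiffAt.of_le (by simp)) R hR
  -- The base points `s (γ t)` and `γ t` equal `x` and `f x` only propositionally, so the norms on the
  -- tangent spaces are compared after generalizing over `x'` and `y`.
  have hnorm : ∀ (x' : M) (y : B), x' = x → y = f x → ∀ (w : TangentSpace (𝓡 m) x')
      (v : TangentSpace (𝓡 n) y), @Eq (EuclideanSpace ℝ (Fin m)) w (R v) → ‖w‖ = ‖v‖ := by
    rintro _ _ rfl rfl _ v rfl
    exact hRn v
  have hsR' : HasMFDerivAt (𝓡 n) (𝓡 m) s (γ t) R := hx ▸ hsR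
  rw [hx] at hs1 hs0 hsf
  refine ⟨s ∘ γ, hs1.comp t hγ, hs0, hγ.continuousAt.eventually hsf, ?_⟩
  rw [(hsR'.comp t (hγ.mdifferentiableAt one_ne_zero).hasMFDerivAt).mfderiv]
  exact hnorm _ _ hs0 hx.symm _ _ rfl

/-! ### The submetry property -/

/-- A Riemannian submersion from a complete manifold is a submetry: the distance from `x` to the
fiber over `b` is at most the distance from `f x` to `b`. -/
theorem IsRiemannianSubmersion.exists_mem_fiber_edist_lt {m n : ℕ}
    {M : Type*} [PseudoEMetricSpace M] [ChartedSpace (EuclideanSpace ℝ (Fin m)) M]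
    [IsManifold (𝓡 m) 1 M]
    [RiemannianBundle (fun x : M => TangentSpace (𝓡 m) x)]
    [IsContinuousRiemannianBundle (EuclideanSpace ℝ (Fin m))
      (fun x : M => TangentSpace (𝓡 m) x)]
    [IsRiemannianManifold (𝓡 m) M] [CompleteSpace M]
    {B : Type*} [EMetricSpace B] [ChartedSpace (EuclideanSpace ℝ (Fin n)) B]
    [IsManifold (𝓡 n) 1 B]
    [RiemannianBundle (fun b : B => TangentSpace (𝓡 n) b)]
    [IsContinuousRiemannianBundle (EuclideanSpace ℝ (Fin n))
      (fun b : B => TangentSpace (𝓡 n) b)]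
    [IsRiemannianManifold (𝓡 n) B]
    {f : M → B} (hf : IsRiemannianSubmersion (m := m) (n := n) f) {x : M} {b : B} {r : ℝ≥0∞}
    (hr : edist (f x) b < r) :
    ∃ y ∈ f ⁻¹' {b}, edist x y < r := by
  rw [IsRiemannianManifold.out (I := 𝓡 n)] at hr
  obtain ⟨γ, hγ0, hγ1, hγ, hlen, -⟩ :=
    exists_lt_locally_constant_of_riemannianEDist_lt hr zero_lt_one
  let v : ℝ → ℝ := fun u => ‖mfderiv 𝓘(ℝ, ℝ) (𝓡 n) γ u 1‖
  have hv : Continuous v :=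
    continuous_iff_continuousAt.2 fun u => continuousAt_norm_mfderiv_one hγ.contMDiffAt
  -- The room `η` absorbs the excess speed of a local lift, whose velocity is horizontal at the initial
  -- time only.
  obtain ⟨η, hη0, hη⟩ := ENNReal.exists_nnreal_pos_mul_lt (a := 1)
    (b := r - pathELength (𝓡 n) γ 0 1) (by simp) (tsub_pos_of_lt hlen).ne'
  rw [mul_one] at hη
  have hη0' : (0 : ℝ) < η := hη0
  have hg : Continuous fun u => v u + η := by fun_prop
  have hgi : ∀ a b, IntervalIntegrable (fun u => v u + η) volume a b :=
    fun a b => hg.intervalIntegrable a b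
  have hg0 : ∀ u, 0 ≤ v u + η := fun u => add_nonneg (norm_nonneg _) hη0'.le
  let F : ℝ → ℝ := fun t => ∫ u in (0 : ℝ)..t, (v u + η)
  have hF : ∀ {s t : ℝ}, s ≤ t →
      ENNReal.ofReal (F t - F s) = ∫⁻ u in Icc s t, ENNReal.ofReal (v u + η) := by
    intro s t hst
    simp only [F]
    rw [intervalIntegral.integral_interval_sub_left (hgi _ _) (hgi _ _),
      intervalIntegral.integral_of_le hst, ← integral_Icc_eq_integral_Ioc,
      ofReal_integral_eq_lintegral_ofReal (hg.integrableOn_Icc) (ae_of_all _ hg0)]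
  have hFmono : Monotone F := by
    intro s t hst
    rw [← sub_nonneg]
    simp only [F]
    rw [intervalIntegral.integral_interval_sub_left (hgi _ _) (hgi _ _)]
    exact intervalIntegral.integral_nonneg hst fun u _ => hg0 u
  have step : ∀ t ∈ Ico (0 : ℝ) 1, ∀ x, f x = γ t →
      ∃ s ∈ Ioc t 1, ∃ y, f y = γ s ∧ edist x y ≤ ENNReal.ofReal (F s - F t) := by
    intro t ht x hx
    obtain ⟨σ, hσ, hσt, hσf, hσn⟩ := hf.exists_local_lift hγ.contMDiffAt hx
    have hspeed : ∀ᶠ u in 𝓝 t, ‖mfderiv 𝓘(ℝ, ℝ) (𝓡 m) σ u 1‖ < v u + η :=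
      (continuousAt_norm_mfderiv_one hσ).eventually_lt hg.continuousAt
        (by rw [hσn]; exact lt_add_of_pos_right _ hη0')
    obtain ⟨δ, hδ, hball⟩ := Metric.eventually_nhds_iff.1
      (((contMDiffAt_iff_contMDiffAt_nhds (by simp)).1 hσ).and (hσf.and hspeed))
    let s := min (t + δ / 2) 1
    have hts : t < s := lt_min (by linarith) ht.2
    have hs : ∀ u ∈ Icc t s, dist u t < δ := by
      intro u hu
      have := hu.2.trans (min_le_left _ _)
      rw [Real.dist_eq, abs_of_nonneg (sub_nonneg.2 hu.1)]
      linarith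
    refine ⟨s, ⟨hts, min_le_right _ _⟩, σ s, (hball (hs s ⟨hts.le, le_rfl⟩)).2.1, ?_⟩
    rw [hF hts.le, IsRiemannianManifold.out (I := 𝓡 m)]
    refine (riemannianEDist_le_pathELength (γ := σ)
      (fun u hu => (hball (hs u hu)).1.contMDiffWithinAt) hσt rfl hts.le).trans ?_
    rw [pathELength_eq_lintegral_mfderiv_Icc]
    refine setLIntegral_mono' measurableSet_Icc fun u hu => ?_
    rw [← ofReal_norm]
    exact ENNReal.ofReal_le_ofReal (hball (hs u hu)).2.2.le
  obtain ⟨y, hy, hxy⟩ := exists_lift_endpoint_of_local_lift hf.contMDiff.continuous hγ.continuous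
    (intervalIntegral.continuous_primitive hgi 0) hFmono zero_le_one step hγ0.symm
  refine ⟨y, hy.trans hγ1, hxy.trans_lt ?_⟩
  calc ENNReal.ofReal (F 1 - F 0)
      = pathELength (𝓡 n) γ 0 1 + η := by
        rw [hF zero_le_one, pathELength_eq_lintegral_mfderiv_Icc]
        simp only [v, ENNReal.ofReal_add (norm_nonneg _) hη0'.le, ofReal_norm]
        rw [lintegral_add_right _ measurable_const]
        simp
    _ < r := lt_tsub_iff_left.1 hη

/-! ### Rough isometries -/

/-- The points at finite distance from `x` form a clopen set. -/
theorem edist_ne_top_of_preconnectedSpace {X : Type*} [PseudoEMetricSpace X]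
    [PreconnectedSpace X] (x y : X) : edist x y ≠ ⊤ := by
  have h : Metric.eball x ⊤ = univ :=
    IsClopen.eq_univ ⟨Metric.isClosed_eball_top, Metric.isOpen_eball⟩
      ⟨x, Metric.mem_eball_self (by simp)⟩
  have hy : y ∈ Metric.eball x ⊤ := h ▸ mem_univ y
  rw [edist_comm]
  exact (Metric.mem_eball.1 hy).ne

theorem exists_edist_le_of_compactSpace {X : Type*} [PseudoEMetricSpace X]
    [CompactSpace X] [PreconnectedSpace X] : ∃ D : ℝ≥0, ∀ x y : X, edist x y ≤ D := by
  rcases isEmpty_or_nonempty X with _ | ⟨⟨x⟩⟩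
  · exact ⟨0, fun x => isEmptyElim x⟩
  obtain ⟨z, -, hz⟩ := (isCompact_univ (X := X)).exists_isMaxOn ⟨x, mem_univ x⟩
    (continuous_const.edist continuous_id : Continuous fun y => edist x y).continuousOn
  refine ⟨(edist x z + edist x z).toNNReal, fun y w => ?_⟩
  rw [ENNReal.coe_toNNReal (by simp [edist_ne_top_of_preconnectedSpace])]
  exact (edist_triangle_left y w x).trans (add_le_add (hz (mem_univ y)) (hz (mem_univ w)))

theorem IsRoughIsometry.of_isometry {X Y : Type*} [PseudoEMetricSpace X] [PseudoEMetricSpace Y]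
    {φ : X → Y} (hφ : Isometry φ) {r : ℝ≥0} (hr : ∀ y, ∃ x, edist y (φ x) < r) :
    IsRoughIsometry φ where
  quasi := ⟨1, 0, le_rfl, fun p q => by simp [hφ p q]⟩
  full := by
    refine ⟨r + 1, by positivity, eq_univ_of_forall fun y => ?_⟩
    obtain ⟨x, hx⟩ := hr y
    rw [Metric.mem_thickening_iff_exists_edist_lt]
    refine ⟨φ x, mem_range_self x, hx.trans_le ?_⟩
    rw [← ENNReal.ofReal_coe_nnreal]
    exact ENNReal.ofReal_le_ofReal (by simp)

/-- If `s` is coarsely dense in `X` and `B` is bounded, then `X` is roughly isometric to `s × B`: send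
`x` to a pair formed by a point of `s` close to `x` and a fixed point of `B`. -/
theorem roughlyIsometric_withLp_prod_of_dense {X B : Type*} [PseudoEMetricSpace X]
    [PseudoEMetricSpace B] {s : Set X} {r D : ℝ≥0} (hr : ∀ x, ∃ y ∈ s, edist x y < r) (b : B)
    (hD : ∀ c, edist c b ≤ D) : RoughlyIsometric X (WithLp 2 (s × B)) := by
  choose ρ hρs hρ using hr
  have hsame : ∀ (y z : s) (c : B),
      edist (WithLp.toLp 2 (y, c)) (WithLp.toLp 2 (z, c)) = edist (y : X) z := by
    intro y z c
    simpa [WithLp.prod_edist_eq_add, Subtype.edist_eq] using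
      ENNReal.rpow_rpow_inv two_ne_zero (edist (y : X) z)
  have hsame' : ∀ (y : s) (c d : B),
      edist (WithLp.toLp 2 (y, c)) (WithLp.toLp 2 (y, d)) = edist c d := by
    intro y c d
    simpa [WithLp.prod_edist_eq_add] using ENNReal.rpow_rpow_inv two_ne_zero (edist c d)
  refine ⟨fun x => WithLp.toLp 2 (⟨ρ x, hρs x⟩, b), ⟨1, 2 * r, le_rfl, fun p q => ?_⟩,
    r + D + 1, by positivity, eq_univ_of_forall fun z => ?_⟩
  · rw [hsame]
    simp only [ENNReal.coe_one, div_one, one_mul, ENNReal.coe_mul, ENNReal.coe_ofNat,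
      tsub_le_iff_right]
    constructor
    · calc edist p q ≤ edist p (ρ p) + edist (ρ p) (ρ q) + edist (ρ q) q := edist_triangle4 _ _ _ _
        _ ≤ r + edist (ρ p) (ρ q) + r := by
          gcongr
          · exact (hρ p).le
          · rw [edist_comm]; exact (hρ q).le
        _ = edist (ρ p) (ρ q) + 2 * r := by ring
    · calc edist (ρ p) (ρ q) ≤ edist (ρ p) p + edist p q + edist q (ρ q) := edist_triangle4 _ _ _ _
        _ ≤ r + edist p q + r := by
          gcongr
          · rw [edist_comm]; exact (hρ p).le
          · exact (hρ q).le
        _ = edist p q + 2 * r := by ring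
  · obtain ⟨⟨y, c⟩, rfl⟩ := WithLp.toLp_surjective 2 z
    rw [Metric.mem_thickening_iff_exists_edist_lt]
    refine ⟨_, mem_range_self (y : X), ?_⟩
    calc edist (WithLp.toLp 2 (y, c)) (WithLp.toLp 2 (⟨ρ y, hρs y⟩, b))
        ≤ edist (WithLp.toLp 2 (y, c)) (WithLp.toLp 2 (y, b)) +
          edist (WithLp.toLp 2 (y, b)) (WithLp.toLp 2 ((⟨ρ y, hρs y⟩ : s), b)) :=
          edist_triangle _ _ _
      _ ≤ D + r := by
        rw [hsame, hsame']
        exact add_le_add (hD c) (hρ y).le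
      _ < ENNReal.ofReal (r + D + 1) := by
        rw [← ENNReal.coe_add, ← ENNReal.ofReal_coe_nnreal]
        refine (ENNReal.ofReal_lt_ofReal_iff (by positivity)).2 ?_
        push_cast
        linarith

end

theorem theorem4p1p2 {m n : ℕ}
    {M : Type*} [EMetricSpace M] [ChartedSpace (EuclideanSpace ℝ (Fin m)) M]
    [IsManifold (𝓡 m) ∞ M]
    [RiemannianBundle (fun x : M => TangentSpace (𝓡 m) x)]
    [IsContMDiffRiemannianBundle (𝓡 m) ∞ (EuclideanSpace ℝ (Fin m))
      (fun x : M => TangentSpace (𝓡 m) x)]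
    [IsRiemannianManifold (𝓡 m) M] [CompleteSpace M]
    {B : Type*} [EMetricSpace B] [ChartedSpace (EuclideanSpace ℝ (Fin n)) B]
    [IsManifold (𝓡 n) ∞ B]
    [RiemannianBundle (fun b : B => TangentSpace (𝓡 n) b)]
    [IsContMDiffRiemannianBundle (𝓡 n) ∞ (EuclideanSpace ℝ (Fin n))
      (fun b : B => TangentSpace (𝓡 n) b)]
    [IsRiemannianManifold (𝓡 n) B] [CompactSpace B] [ConnectedSpace B]
    (f : M → B) (hf : IsRiemannianSubmersion (m := m) (n := n) f) :
    (∀ b : B, IsRoughIsometry (Subtype.val : (f ⁻¹' {b} : Set M) → M)) ∧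
      ∀ b : B, RoughlyIsometric M (WithLp 2 ((f ⁻¹' {b} : Set M) × B)) := by
  have := isContinuousRiemannianBundle_of_isContMDiffRiemannianBundle (𝓡 m) (M := M)
  have := isContinuousRiemannianBundle_of_isContMDiffRiemannianBundle (𝓡 n) (M := B)
  obtain ⟨D, hD⟩ := exists_edist_le_of_compactSpace (X := B)
  have hfiber : ∀ (b : B) (x : M), ∃ y ∈ f ⁻¹' {b}, edist x y < (D + 1 : ℝ≥0) := fun b x =>
    hf.exists_mem_fiber_edist_lt ((hD (f x) b).trans_lt (by
      exact_mod_cast lt_add_one D))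
  refine ⟨fun b => .of_isometry isometry_subtype_coe (r := D + 1) fun x => ?_, fun b =>
    roughlyIsometric_withLp_prod_of_dense (hfiber b) b fun c => hD c b⟩
  obtain ⟨y, hy, hxy⟩ := hfiber b x
  exact ⟨⟨y, hy⟩, hxy⟩
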